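/- Let $\mathcal X$ be a measurable space with a $\sigma$-finite measure $\nu$, let $\mathcal K$ be a countable set, and for each $k\in\mathcal K$ let $\Theta^{(k)}$ be a measurable space and $\{P_{k,\theta}:\theta\in\Theta^{(k)}\}$ a family of probability measures on $\mathcal X$ with densities $p(x\mid k,\theta)$ with respect to $\nu$, jointly measurable in $(\theta,x)$. Let $\pi$ be a probability distribution on $\mathcal K$, and for each $k$ let $\Pi^{(k)}$ be a probability measure (prior) on $\Theta^{(k)}$. The posterior in model $k$ is $$d\Pi^{(k)}(\theta\mid X)=\frac{p(X\mid k,\theta)\,d\Pi^{(k)}(\theta)}{\int p(X\mid k,\vartheta)\,d\Pi^{(k)}(\vartheta)} .$$ The observation $X$ is drawn from a probability measure $P^*$ on $\mathcal X$. Let $\widehat k=\widehat k(X)$ be a measurable selection with, $P^*$-almost surely, $$\widehat k\in\operatorname*{argmax}_{k\in\mathcal K}\ \log\Big[\pi(k)\int p(X\mid k,\theta)\,d\Pi^{(k)}(\theta)\Big],$$ and call $\Pi^{(\widehat k)}(\cdot\mid X)$ the empirical Bayes posterior. For $\rho>1$ write $D_\rho(P\|Q)=\frac1{\rho-1}\log\int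 (dP/dQ)^{\rho-1}dP$ for the $\rho$-Rényi divergence ($=\infty$ if $P\not\ll Q$). A testing function is a measurable $\phi:\mathcal X\to[0,1]$; $P\phi$ denotes $\int\phi\,dP$, and a supremum over the empty set is $0$. Let $L(\cdot,\cdot)\ge 0$ be a loss function (possibly infinite-valued) such that $\theta\mapsto L(P^*,P_{k,\theta})$ is measurable for every $k$, let $\epsilon_*\ge 1$, let $\rho>1$, and let $C,C_1,C_2,C_3>0$ satisfy $C>C_2+C_3+2$. Assume: 1. (Testing and sieve) For every $\epsilon\ge\epsilon_*$ there exist a subset $\bar{\mathcal K}\subseteq\mathcal K$, measurable subsets $\mathcal F_k\subseteq\Theta^{(k)}$ ($k\in\mathcal K$) and a testing function $\phi$ such that both $$P^*\phi+\sup_{\substack{k\in\bar{\mathcal K},\ \theta\in\mathcal F_k\\ L(P^*,P_{k,\theta})\ge C_1\epsilon^2}}P_{k,\theta}(1-\phi)\le e^{-C\epsilon^2} \quad\text{and}\quad \sum_{k\notin\bar{\mathcal K}}\pi(k)+\sum_{k\in\bar{\mathcal K}}\pi(k)\,\Pi^{(k)}(\mathcal F_k^c)\le e^{-C\epsilon^2}.$$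 2. (Prior mass) There exists $k^*\in\mathcal K$ such that $$\pi(k^*)\,\Pi^{(k^*)}\big(\{\theta\in\Theta^{(k^*)}: D_\rho(P^*\|P_{k^*,\theta})\le C_3\epsilon_*^2\}\big)\ge e^{-C_2\epsilon_*^2}.$$ Then $$P^*\int L(P^*,P_{\widehat k,\theta})\,d\Pi^{(\widehat k)}(\theta\mid X)\le M\epsilon_*^2$$ for some constant $M>0$ depending only on $C$, $C_1$ and $\rho$. -/

import Mathlib

open MeasureTheory Set
open scoped ENNReal

noncomputable section

/-- The Rényi divergence `D_ρ(P‖Q) = (ρ - 1)⁻¹ log ∫ (dP/dQ)^(ρ-1) dP` of order `ρ > 1`,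
with value `⊤` when `P` is not absolutely continuous with respect to `Q`. -/
def renyiDiv {𝒳 : Type*} [MeasurableSpace 𝒳] (ρ : ℝ) (P Q : Measure 𝒳) : EReal :=
  open Classical in
  if P ≪ Q then
    (((ρ - 1)⁻¹ : ℝ) : EReal) * ENNReal.log (∫⁻ x, (P.rnDeriv Q x) ^ (ρ - 1) ∂P)
  else ⊤

/-- A family of statistical models indexed by `k`, the `k`-th one with its own parameter space
`Θ k`, given by likelihoods `p(x | k, θ)`: probability densities with respect to a common
dominating measure `ν`, jointly measurable in `(θ, x)`. -/
structure ModelFamily {𝒳 : Type*} [MeasurableSpace 𝒳] (ν : Measure 𝒳)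
    {𝒦 : Type*} (Θ : 𝒦 → Type*) [∀ k, MeasurableSpace (Θ k)] where
  /-- the likelihood `p(x | k, θ)` -/
  density : ∀ k, Θ k → 𝒳 → ℝ≥0∞
  measurable_density : ∀ k, Measurable (Function.uncurry (density k))
  lintegral_density : ∀ k θ, ∫⁻ x, density k θ x ∂ν = 1

namespace ModelFamily

variable {𝒳 : Type*} [MeasurableSpace 𝒳] {ν : Measure 𝒳}
  {𝒦 : Type*} {Θ : 𝒦 → Type*} [∀ k, MeasurableSpace (Θ k)]

/-- The distribution `P_{k,θ}` with density `p(· | k, θ)`. -/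
def law (M : ModelFamily ν Θ) (k : 𝒦) (θ : Θ k) : Measure 𝒳 :=
  ν.withDensity (M.density k θ)

/-- The marginal likelihood `∫ p(x | k, θ) dΠ⁽ᵏ⁾(θ)` of model `k`. -/
def marginal (M : ModelFamily ν Θ) (prior : ∀ k, Measure (Θ k)) (k : 𝒦) (x : 𝒳) : ℝ≥0∞ :=
  ∫⁻ θ, M.density k θ x ∂(prior k)

/-- The posterior `Π⁽ᵏ⁾(· | x)` within model `k`: `dΠ⁽ᵏ⁾(θ | x) ∝ p(x | k, θ) dΠ⁽ᵏ⁾(θ)`,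
normalized by the marginal likelihood. -/
def posterior (M : ModelFamily ν Θ) (prior : ∀ k, Measure (Θ k)) (k : 𝒦) (x : 𝒳) :
    Measure (Θ k) :=
  (M.marginal prior k x)⁻¹ • (prior k).withDensity (fun θ => M.density k θ x)

/-- `khat` maximizes `log [w(k) ∫ p(X | k, θ) dΠ⁽ᵏ⁾(θ)]` over all `k`, almost surely when
`X ∼ P`. -/
def IsMaxMarginal (M : ModelFamily ν Θ) (prior : ∀ k, Measure (Θ k)) (w : 𝒦 → ℝ≥0∞)
    (P : Measure 𝒳) (khat : 𝒳 → 𝒦) : Prop :=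
  ∀ᵐ x ∂P, IsMaxOn (fun k => ENNReal.log (w k * M.marginal prior k x)) univ (khat x)

/-- Every `P_{k,θ}` is a probability measure. -/
theorem isProbabilityMeasure_law (M : ModelFamily ν Θ) (k : 𝒦) (θ : Θ k) :
    IsProbabilityMeasure (M.law k θ) :=
  ⟨by simpa [law] using M.lintegral_density k θ⟩

/-- The posterior is a probability measure wherever the marginal likelihood is positive and
finite. -/
theorem isProbabilityMeasure_posterior (M : ModelFamily ν Θ) (prior : ∀ k, Measure (Θ k))
    (k : 𝒦) (x : 𝒳) (h0 : M.marginal prior k x ≠ 0) (h1 : M.marginal prior k x ≠ ∞) :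
    IsProbabilityMeasure (M.posterior prior k x) :=
  ⟨by simpa [posterior, marginal] using ENNReal.inv_mul_cancel h0 h1⟩

end ModelFamily

end

/-! The argmax property reduces empirical Bayes to hierarchical Bayes. Multiply numerator and
denominator of the posterior in the selected model by its weight: the denominator is at least the
weighted evidence of model `k*`, and the numerator is one term of the sum over all models. No price
is paid for the data-driven choice (`posterior_le_of_isMaxOn`).

Two bounds remain. The evidence of `k*` is rarely small (`measure_lintegral_le_mul_le`,
`measure_marginal_le_mul_le`): a tangent line to `t ↦ t ^ (-s)` replaces Jensen's inequality, and a
Markov-type argument uses the moment of order `ρ - 1` that the Rényi divergence controls. The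
numerator, damped by `1 - φ` and integrated against `ν`, is at most the type-II error plus the prior
mass off the sieve (`lintegral_mul_tsum_setLIntegral_le`).

Together they give an exponential tail for the loss at each level `C₁ * ε ^ 2`
(`lintegral_posterior_loss_ge_le`). Summing over levels `C₁ * (ε₀ ^ 2 + n)` yields geometric series
depending only on `ρ`. -/

/-- Tangent-line inequality for `t ↦ t ^ (-s)` at `t = 1`, with `t = q / a`. -/
theorem one_add_le_div_rpow_add_mul_div {s : ℝ} (hs : 0 < s) {a : ℝ≥0∞} (ha : a ≠ 0)
    (ha' : a ≠ ∞) (q : ℝ≥0∞) :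
    1 + ENNReal.ofReal s ≤ (a / q) ^ s + ENNReal.ofReal s / a * q := by
  have hsa : ENNReal.ofReal s / a ≠ 0 := by simp [hs, ha']
  rcases eq_or_ne q 0 with rfl | hq
  · simp [ENNReal.div_zero ha, ENNReal.top_rpow_of_pos hs]
  rcases eq_or_ne q ∞ with rfl | hq'
  · simp [ENNReal.mul_top hsa]
  lift a to NNReal using ha'
  lift q to NNReal using hq'
  have ha0 : 0 < (a : ℝ) := by
    have : a ≠ 0 := by exact_mod_cast ha
    positivity
  have hq0 : 0 < (q : ℝ) := by
    have : q ≠ 0 := by exact_mod_cast hq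
    positivity
  have e1 : (a : ℝ≥0∞) = ENNReal.ofReal a := by simp
  have e2 : (q : ℝ≥0∞) = ENNReal.ofReal q := by simp
  rw [e1, e2, ← ENNReal.ofReal_div_of_pos hq0, ENNReal.ofReal_rpow_of_pos (by positivity),
    ← ENNReal.ofReal_div_of_pos ha0, ← ENNReal.ofReal_mul (by positivity),
    ← ENNReal.ofReal_add (by positivity) (by positivity), ← ENNReal.ofReal_one,
    ← ENNReal.ofReal_add (by positivity) (by positivity)]
  apply ENNReal.ofReal_le_ofReal
  -- With `t = q / a`: `t ^ (-s) = exp (-s log t) ≥ 1 - s log t ≥ 1 - s (t - 1)`.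
  have h1 := Real.add_one_le_exp (Real.log ((a : ℝ) / q) * s)
  rw [← Real.rpow_def_of_pos (by positivity)] at h1
  have h2 := Real.log_le_sub_one_of_pos (x := (q : ℝ) / a) (by positivity)
  have h3 : Real.log ((a : ℝ) / q) = - Real.log ((q : ℝ) / a) := by
    rw [← Real.log_inv, inv_div]
  have h4 : s / (a : ℝ) * q = s * ((q : ℝ) / a) := by ring
  rw [h3] at h1
  rw [h4]
  nlinarith [mul_le_mul_of_nonneg_left h2 hs.le]

/-- A mixture `∫ f θ dμ(θ)` is unlikely to be much smaller than `μ univ * g` when the moments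
`∫ (g / f θ) ^ s dP` are controlled. -/
theorem measure_lintegral_le_mul_le {Ω 𝒳 : Type*} [MeasurableSpace Ω] [MeasurableSpace 𝒳]
    (μ : Measure Ω) [IsFiniteMeasure μ] (hμ : μ univ ≠ 0) (P : Measure 𝒳) [SFinite P]
    {f : Ω → 𝒳 → ℝ≥0∞} (hf : Measurable (Function.uncurry f)) {g : 𝒳 → ℝ≥0∞}
    (hg : Measurable g) (hg0 : ∀ᵐ x ∂P, g x ≠ 0) (hg1 : ∀ᵐ x ∂P, g x ≠ ∞)
    {s : ℝ} (hs : 0 < s) {R : ℝ≥0∞} (hR : ∀ᵐ θ ∂μ, ∫⁻ x, (g x / f θ x) ^ s ∂P ≤ R)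
    {κ : ℝ≥0∞} (hκ0 : κ ≠ 0) (hκ1 : κ ≠ ∞) :
    P {x | ∫⁻ θ, f θ x ∂μ ≤ κ * g x * μ univ} ≤ κ ^ s * R := by
  have hμ' : μ univ ≠ ∞ := measure_ne_top μ univ
  have hfx : ∀ x, Measurable fun θ => f θ x := fun x => hf.comp measurable_prodMk_right
  have hm : Measurable fun p : 𝒳 × Ω => (g p.1 / f p.2 p.1) ^ s :=
    ((hg.comp measurable_fst).div (hf.comp measurable_swap)).pow_const s
  set E := {x | ∫⁻ θ, f θ x ∂μ ≤ κ * g x * μ univ} with hE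
  have hEm : MeasurableSet E :=
    measurableSet_le (Measurable.lintegral_prod_left hf) ((hg.const_mul κ).mul_const _)
  -- Integrate the tangent-line inequality at `a = κ * g x` over `μ`. On `E` the linear term is at
  -- most `s * μ univ`, which cancels against the left side; what remains is a lower bound for the
  -- integrated moment, ready for Markov's argument.
  have key : ∀ᵐ x ∂P, x ∈ E → μ univ ≤ κ ^ s * ∫⁻ θ, (g x / f θ x) ^ s ∂μ := by
    filter_upwards [hg0, hg1] with x h0 h1 hx
    have ha0 : κ * g x ≠ 0 := mul_ne_zero hκ0 h0
    have ha1 : κ * g x ≠ ∞ := ENNReal.mul_ne_top hκ1 h1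
    have hmx : Measurable fun θ => (κ * g x / f θ x) ^ s :=
      ((measurable_const).div (hfx x)).pow_const s
    have h2 : (1 + ENNReal.ofReal s) * μ univ ≤
        ∫⁻ θ, (κ * g x / f θ x) ^ s ∂μ +
          ENNReal.ofReal s / (κ * g x) * ∫⁻ θ, f θ x ∂μ := by
      rw [← lintegral_const_mul _ (hfx x), ← lintegral_add_left hmx, ← lintegral_const]
      exact lintegral_mono fun θ => one_add_le_div_rpow_add_mul_div hs ha0 ha1 _
    have h3 : ENNReal.ofReal s / (κ * g x) * ∫⁻ θ, f θ x ∂μ ≤ ENNReal.ofReal s * μ univ := by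
      calc _ ≤ ENNReal.ofReal s / (κ * g x) * (κ * g x * μ univ) := by gcongr; exact hx
        _ = _ := by rw [← mul_assoc, ENNReal.div_mul_cancel ha0 ha1]
    rw [add_mul, one_mul] at h2
    have h4 := ENNReal.le_of_add_le_add_right (ENNReal.mul_ne_top ENNReal.ofReal_ne_top hμ')
      (h2.trans (by gcongr))
    refine h4.trans (le_of_eq ?_)
    rw [← lintegral_const_mul' _ _ (ENNReal.rpow_ne_top_of_nonneg hs.le hκ1)]
    refine lintegral_congr fun θ => ?_
    rw [mul_div_assoc, ENNReal.mul_rpow_of_nonneg _ _ hs.le]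
  have h5 : μ univ * P E ≤ κ ^ s * R * μ univ := by
    calc μ univ * P E = ∫⁻ _ in E, μ univ ∂P := (setLIntegral_const _ _).symm
      _ ≤ ∫⁻ x in E, κ ^ s * ∫⁻ θ, (g x / f θ x) ^ s ∂μ ∂P :=
        lintegral_mono_ae ((ae_restrict_iff' hEm).2 key)
      _ ≤ ∫⁻ x, κ ^ s * ∫⁻ θ, (g x / f θ x) ^ s ∂μ ∂P := setLIntegral_le_lintegral _ _
      _ = κ ^ s * ∫⁻ θ, ∫⁻ x, (g x / f θ x) ^ s ∂P ∂μ := by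
        rw [lintegral_const_mul _ (Measurable.lintegral_prod_right hm),
          lintegral_lintegral_swap hm.aemeasurable]
      _ ≤ κ ^ s * ∫⁻ _, R ∂μ := by gcongr 1; exact lintegral_mono_ae hR
      _ = _ := by rw [lintegral_const, mul_assoc]
  rw [mul_comm] at h5
  exact (ENNReal.mul_le_mul_iff_left hμ hμ').1 h5

/-- A value is bounded by the staircase with steps of width `b` starting at level `a`. -/
theorem le_ofReal_add_tsum_ite {a b : ℝ} (ha : 0 ≤ a) (hb : 0 < b) (y : ℝ≥0∞) :
    y ≤ ENNReal.ofReal a +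
      ∑' n : ℕ, if ENNReal.ofReal (a + b * n) ≤ y then ENNReal.ofReal b else 0 := by
  rcases eq_or_ne y ∞ with rfl | hy
  · have : ENNReal.ofReal b ≠ 0 := by simp [hb]
    simp [ENNReal.tsum_const_eq_top_of_ne_zero this]
  lift y to NNReal using hy
  -- Exactly the steps `n < m` start strictly below `y`; the natural-number ceiling is `0` when `y ≤
  -- a`.
  set m := ⌈((y : ℝ) - a) / b⌉₊ with hm
  have h1 : (y : ℝ) ≤ a + b * m := by
    have := Nat.le_ceil (((y : ℝ) - a) / b)
    rw [div_le_iff₀ hb] at this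
    linarith
  have e : (y : ℝ≥0∞) = ENNReal.ofReal y := by simp
  have h2 : ∀ n ∈ Finset.range m, ENNReal.ofReal (a + b * n) ≤ y := fun n hn => by
    have := Nat.lt_ceil.1 (Finset.mem_range.1 hn)
    rw [lt_div_iff₀ hb] at this
    rw [e]
    exact ENNReal.ofReal_le_ofReal (by linarith)
  calc (y : ℝ≥0∞) ≤ ENNReal.ofReal (a + b * m) := by
        rw [e]; exact ENNReal.ofReal_le_ofReal h1
    _ = ENNReal.ofReal a + ∑ n ∈ Finset.range m,
        if ENNReal.ofReal (a + b * n) ≤ y then ENNReal.ofReal b else 0 := by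
      rw [Finset.sum_congr rfl fun n hn => if_pos (h2 n hn),
        ENNReal.ofReal_add ha (by positivity), ENNReal.ofReal_mul hb.le]
      simp [mul_comm]
    _ ≤ _ := by gcongr; exact ENNReal.sum_le_tsum _

/-! ### Rényi neighbourhoods and the evidence lower bound -/

theorem absolutelyContinuous_of_renyiDiv_le {𝒳 : Type*} [MeasurableSpace 𝒳] {ρ r : ℝ}
    {P Q : Measure 𝒳} (h : renyiDiv ρ P Q ≤ (r : EReal)) : P ≪ Q := by
  by_contra hPQ
  simp [renyiDiv, hPQ] at h

theorem lintegral_rnDeriv_rpow_le_of_renyiDiv_le {𝒳 : Type*} [MeasurableSpace 𝒳] {ρ r : ℝ}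
    (hρ : 1 < ρ) {P Q : Measure 𝒳} (h : renyiDiv ρ P Q ≤ (r : EReal)) :
    ∫⁻ x, (P.rnDeriv Q x) ^ (ρ - 1) ∂P ≤ ENNReal.ofReal (Real.exp r) ^ (ρ - 1) := by
  have hPQ := absolutelyContinuous_of_renyiDiv_le h
  rw [renyiDiv, if_pos hPQ] at h
  have h1 := EReal.exp_monotone h
  rwa [← ENNReal.rpow_eq_exp_mul_log, EReal.exp_coe,
    ENNReal.rpow_inv_le_iff (by linarith)] at h1

theorem measurable_comp_selection {𝒳 𝒦 β : Type*} [MeasurableSpace 𝒳] [Countable 𝒦]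
    [MeasurableSpace 𝒦] [DiscreteMeasurableSpace 𝒦] [MeasurableSpace β] {f : 𝒦 → 𝒳 → β}
    (hf : ∀ k, Measurable (f k)) {khat : 𝒳 → 𝒦} (hk : Measurable khat) :
    Measurable fun x => f (khat x) x :=
  (measurable_from_prod_countable_right (f := Function.uncurry f) hf).comp
    (hk.prodMk measurable_id)

namespace ModelFamily

variable {𝒳 : Type*} [MeasurableSpace 𝒳] {ν : Measure 𝒳}
  {𝒦 : Type*} {Θ : 𝒦 → Type*} [∀ k, MeasurableSpace (Θ k)]

theorem measurable_density_left (M : ModelFamily ν Θ) (k : 𝒦) (x : 𝒳) :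
    Measurable fun θ => M.density k θ x :=
  (M.measurable_density k).comp measurable_prodMk_right

theorem measurable_density_right (M : ModelFamily ν Θ) (k : 𝒦) (θ : Θ k) :
    Measurable (M.density k θ) :=
  (M.measurable_density k).comp measurable_prodMk_left

theorem law_absolutelyContinuous (M : ModelFamily ν Θ) (k : 𝒦) (θ : Θ k) : M.law k θ ≪ ν :=
  withDensity_absolutelyContinuous _ _

/-- This is the chain rule for densities, valid `ν`-a.e. and hence `P`-a.e. Division by the
likelihood is legitimate because it is nonzero wherever `dP/dν > 0`, and finite a.e. since it
integrates to one. -/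
theorem rnDeriv_law_ae_eq (M : ModelFamily ν Θ) [SigmaFinite ν] (P : Measure 𝒳) [SigmaFinite P]
    (k : 𝒦) (θ : Θ k) (hP : P ≪ M.law k θ) :
    P.rnDeriv (M.law k θ) =ᵐ[P] fun x => P.rnDeriv ν x / M.density k θ x := by
  have := M.isProbabilityMeasure_law k θ
  have hPν := hP.trans (M.law_absolutelyContinuous k θ)
  have h1 := hPν.ae_le (Measure.rnDeriv_mul_rnDeriv (κ := ν) hP)
  have h2 := hPν.ae_le (Measure.rnDeriv_withDensity ν (M.measurable_density_right k θ))
  have h3 : ∀ᵐ x ∂P, M.density k θ x < ∞ := hPν.ae_le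
    (ae_lt_top (M.measurable_density_right k θ) (by simp [M.lintegral_density]))
  filter_upwards [h1, h2, h3, Measure.rnDeriv_pos hPν] with x e1 e2 h3 h4
  have e2' : (M.law k θ).rnDeriv ν x = M.density k θ x := e2
  rw [Pi.mul_apply, e2'] at e1
  rw [← e1] at h4 ⊢
  rw [ENNReal.mul_div_cancel_right (right_ne_zero_of_mul h4.ne') h3.ne]

theorem lintegral_div_rpow_le_of_renyiDiv_le (M : ModelFamily ν Θ) [SigmaFinite ν]
    (P : Measure 𝒳) [SigmaFinite P] {ρ r : ℝ} (hρ : 1 < ρ) (k : 𝒦) (θ : Θ k)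
    (h : renyiDiv ρ P (M.law k θ) ≤ (r : EReal)) :
    ∫⁻ x, (P.rnDeriv ν x / M.density k θ x) ^ (ρ - 1) ∂P ≤
      ENNReal.ofReal (Real.exp r) ^ (ρ - 1) := by
  refine le_trans (le_of_eq (lintegral_congr_ae ?_))
    (lintegral_rnDeriv_rpow_le_of_renyiDiv_le hρ h)
  filter_upwards [M.rnDeriv_law_ae_eq P k θ (absolutelyContinuous_of_renyiDiv_le h)] with x hx
  rw [hx]

/-- Evidence lower bound: if the prior puts positive mass on a Rényi neighbourhood of `P`, the
marginal likelihood is rarely small compared to the density of `P`. -/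
theorem measure_marginal_le_mul_le (M : ModelFamily ν Θ) [SigmaFinite ν]
    (prior : ∀ k, Measure (Θ k)) [∀ k, IsProbabilityMeasure (prior k)] (P : Measure 𝒳)
    [IsProbabilityMeasure P] {ρ r : ℝ} (hρ : 1 < ρ) (k : 𝒦)
    (hk : prior k {θ | renyiDiv ρ P (M.law k θ) ≤ (r : EReal)} ≠ 0)
    {κ : ℝ≥0∞} (hκ0 : κ ≠ 0) (hκ1 : κ ≠ ∞) :
    P {x | M.marginal prior k x ≤
        κ * P.rnDeriv ν x * prior k {θ | renyiDiv ρ P (M.law k θ) ≤ (r : EReal)}} ≤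
      κ ^ (ρ - 1) * ENNReal.ofReal (Real.exp r) ^ (ρ - 1) := by
  set B := {θ | renyiDiv ρ P (M.law k θ) ≤ (r : EReal)} with hB
  -- `B'` contains `B` and is measurable by joint measurability of the densities, whereas
  -- measurability of `B` is not assumed. Restricting the prior to `B'` can only increase the mass
  -- in the bound.
  set B' := {θ | ∫⁻ x, (P.rnDeriv ν x / M.density k θ x) ^ (ρ - 1) ∂P ≤
      ENNReal.ofReal (Real.exp r) ^ (ρ - 1)} with hB'
  have hBB' : B ⊆ B' := fun θ hθ => M.lintegral_div_rpow_le_of_renyiDiv_le P hρ k θ hθ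
  obtain ⟨θ₀, hθ₀⟩ := nonempty_of_measure_ne_zero hk
  have hPν : P ≪ ν :=
    (absolutelyContinuous_of_renyiDiv_le hθ₀).trans (M.law_absolutelyContinuous k θ₀)
  have hm : Measurable fun p : Θ k × 𝒳 => (P.rnDeriv ν p.2 / M.density k p.1 p.2) ^ (ρ - 1) :=
    (((Measure.measurable_rnDeriv P ν).comp measurable_snd).div
      (M.measurable_density k)).pow_const _
  have hB'm : MeasurableSet B' :=
    measurableSet_le (Measurable.lintegral_prod_right hm) measurable_const
  have hle : prior k B ≤ prior k B' := measure_mono hBB'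
  have hμ : (prior k).restrict B' univ ≠ 0 := by
    rw [Measure.restrict_apply_univ]
    exact fun h => hk (le_antisymm (hle.trans h.le) zero_le)
  refine le_trans (measure_mono fun x hx => ?_)
    (measure_lintegral_le_mul_le ((prior k).restrict B') hμ P (M.measurable_density k)
      (Measure.measurable_rnDeriv P ν) ?_ ?_ (sub_pos.2 hρ) ?_ hκ0 hκ1)
  · calc ∫⁻ θ in B', M.density k θ x ∂(prior k) ≤ M.marginal prior k x :=
        setLIntegral_le_lintegral _ _
      _ ≤ κ * P.rnDeriv ν x * prior k B := hx
      _ ≤ _ := by rw [Measure.restrict_apply_univ]; gcongr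
  · exact (Measure.rnDeriv_pos hPν).mono fun x hx => hx.ne'
  · exact hPν.ae_le ((Measure.rnDeriv_lt_top P ν).mono fun x hx => hx.ne)
  · exact ae_restrict_of_forall_mem hB'm fun θ hθ => hθ

/-! ### Tail masses of the empirical Bayes posterior -/

theorem posterior_apply (M : ModelFamily ν Θ) (prior : ∀ k, Measure (Θ k)) (k : 𝒦) (x : 𝒳)
    {A : Set (Θ k)} (hA : MeasurableSet A) :
    M.posterior prior k x A =
      (M.marginal prior k x)⁻¹ * ∫⁻ θ in A, M.density k θ x ∂(prior k) := by
  simp [posterior, withDensity_apply _ hA]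

/-- No positivity or finiteness of the marginal is needed: when it is `0` or `∞`, the convention `0
* ∞ = 0` makes the total mass zero. -/
theorem posterior_le_one (M : ModelFamily ν Θ) (prior : ∀ k, Measure (Θ k)) (k : 𝒦) (x : 𝒳)
    (A : Set (Θ k)) : M.posterior prior k x A ≤ 1 := by
  refine (measure_mono (subset_univ A)).trans ?_
  rw [posterior_apply M prior k x MeasurableSet.univ, setLIntegral_univ]
  exact ENNReal.inv_mul_le_one _

theorem measurable_setLIntegral_density (M : ModelFamily ν Θ) (prior : ∀ k, Measure (Θ k))
    [∀ k, SFinite (prior k)] (k : 𝒦) (A : Set (Θ k)) :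
    Measurable fun x => ∫⁻ θ in A, M.density k θ x ∂(prior k) :=
  Measurable.lintegral_prod_left (M.measurable_density k)

theorem measurable_marginal (M : ModelFamily ν Θ) (prior : ∀ k, Measure (Θ k))
    [∀ k, SFinite (prior k)] (k : 𝒦) : Measurable (M.marginal prior k) :=
  Measurable.lintegral_prod_left (M.measurable_density k)

theorem measurable_posterior_selection (M : ModelFamily ν Θ) (prior : ∀ k, Measure (Θ k))
    [∀ k, SFinite (prior k)] [Countable 𝒦] [MeasurableSpace 𝒦] [DiscreteMeasurableSpace 𝒦]
    {A : ∀ k, Set (Θ k)} (hA : ∀ k, MeasurableSet (A k)) {khat : 𝒳 → 𝒦} (hk : Measurable khat) :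
    Measurable fun x => M.posterior prior (khat x) x (A (khat x)) := by
  refine measurable_comp_selection (f := fun k x => M.posterior prior k x (A k)) (fun k => ?_) hk
  have hm : Measurable fun x =>
      (M.marginal prior k x)⁻¹ * ∫⁻ θ in A k, M.density k θ x ∂(prior k) :=
    (M.measurable_marginal prior k).inv.mul (M.measurable_setLIntegral_density prior k (A k))
  exact (funext fun x => M.posterior_apply prior k x (hA k)) ▸ hm

/-- Where `k` maximizes the weighted marginal likelihood, its posterior is dominated by the
hierarchical numerator over any lower bound of a weighted marginal likelihood. -/
theorem posterior_le_of_isMaxOn (M : ModelFamily ν Θ) (prior : ∀ k, Measure (Θ k))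
    (w : PMF 𝒦) {x : 𝒳} {k l : 𝒦}
    (hk : IsMaxOn (fun k => ENNReal.log (w k * M.marginal prior k x)) univ k)
    {A : ∀ k, Set (Θ k)} (hA : ∀ k, MeasurableSet (A k)) {d : ℝ≥0∞} (hd : d ≠ 0)
    (hdl : d ≤ w l * M.marginal prior l x) :
    M.posterior prior k x (A k) ≤
      d⁻¹ * ∑' j, w j * ∫⁻ θ in A j, M.density j θ x ∂(prior j) := by
  have h1 : d ≤ w k * M.marginal prior k x :=
    hdl.trans (ENNReal.log_le_log_iff.1 (hk (mem_univ l)))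
  have h2 : w k * M.marginal prior k x ≠ 0 := fun h => hd (le_antisymm (h ▸ h1) zero_le)
  have hw := left_ne_zero_of_mul h2
  have hm := right_ne_zero_of_mul h2
  -- The weight `w k`, absent from the posterior's normalization, is restored here so that the
  -- maximality bound applies to the denominator.
  have h3 : (M.marginal prior k x)⁻¹ ≤ d⁻¹ * w k := by
    calc (M.marginal prior k x)⁻¹ = (w k * M.marginal prior k x)⁻¹ * w k := by
          rw [ENNReal.mul_inv (.inl hw) (.inr hm), mul_right_comm,
            ENNReal.inv_mul_cancel hw (w.apply_ne_top k), one_mul]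
      _ ≤ _ := by gcongr
  rw [M.posterior_apply prior k x (hA k)]
  calc _ ≤ d⁻¹ * w k * ∫⁻ θ in A k, M.density k θ x ∂(prior k) := by gcongr
    _ ≤ _ := by
      rw [mul_assoc]
      gcongr
      exact ENNReal.le_tsum k

/-- By Tonelli, the expected numerator becomes a prior average of expectations under the model laws,
where the type-II error bound applies. -/
theorem lintegral_mul_setLIntegral_density (M : ModelFamily ν Θ) [SFinite ν]
    (prior : ∀ k, Measure (Θ k)) [∀ k, SFinite (prior k)] (k : 𝒦) (A : Set (Θ k))
    {ψ : 𝒳 → ℝ≥0∞} (hψ : Measurable ψ) :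
    ∫⁻ x, ψ x * ∫⁻ θ in A, M.density k θ x ∂(prior k) ∂ν =
      ∫⁻ θ in A, ∫⁻ x, ψ x ∂(M.law k θ) ∂(prior k) := by
  have hm : Measurable fun p : 𝒳 × Θ k => ψ p.1 * M.density k p.2 p.1 :=
    (hψ.comp measurable_fst).mul ((M.measurable_density k).comp measurable_swap)
  calc _ = ∫⁻ x, ∫⁻ θ in A, ψ x * M.density k θ x ∂(prior k) ∂ν :=
        lintegral_congr fun x => (lintegral_const_mul _ (M.measurable_density_left k x)).symm
    _ = ∫⁻ θ in A, ∫⁻ x, ψ x * M.density k θ x ∂ν ∂(prior k) :=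
        lintegral_lintegral_swap hm.aemeasurable
    _ = _ := lintegral_congr fun θ => by
        rw [law, lintegral_withDensity_eq_lintegral_mul _ (M.measurable_density_right k θ) hψ]
        simp [mul_comm]

theorem lintegral_law_le_one (M : ModelFamily ν Θ) (k : 𝒦) (θ : Θ k) {ψ : 𝒳 → ℝ≥0∞}
    (hψ1 : ∀ x, ψ x ≤ 1) : ∫⁻ x, ψ x ∂(M.law k θ) ≤ 1 := by
  have := M.isProbabilityMeasure_law k θ
  exact (lintegral_mono hψ1).trans (by simp)

/-- The expected hierarchical numerator of a set, weighted by a type-II test error `ψ`, is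
bounded by the error on the sieve plus the prior mass off the sieve. -/
theorem lintegral_mul_tsum_setLIntegral_le (M : ModelFamily ν Θ) [SFinite ν] [Countable 𝒦]
    (prior : ∀ k, Measure (Θ k)) [∀ k, IsProbabilityMeasure (prior k)] (w : PMF 𝒦)
    {A F : ∀ k, Set (Θ k)} (hF : ∀ k, MeasurableSet (F k))
    (hA : ∀ k, MeasurableSet (A k)) (K : Set 𝒦) {ψ : 𝒳 → ℝ≥0∞} (hψ : Measurable ψ)
    (hψ1 : ∀ x, ψ x ≤ 1) {S : ℝ≥0∞}
    (hS : ∀ k ∈ K, ∀ θ ∈ F k, θ ∈ A k → ∫⁻ x, ψ x ∂(M.law k θ) ≤ S) :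
    ∫⁻ x, ψ x * ∑' k, w k * ∫⁻ θ in A k, M.density k θ x ∂(prior k) ∂ν ≤
      S + ((∑' k : ↥Kᶜ, w k) + (∑' k : ↥K, w k * prior k (F k)ᶜ)) := by
  have h1 : ∀ k, ∫⁻ θ in A k, ∫⁻ x, ψ x ∂(M.law k θ) ∂(prior k) ≤ 1 := fun k =>
    (setLIntegral_le_lintegral _ _).trans
      ((lintegral_mono fun θ => M.lintegral_law_le_one k θ hψ1).trans (by simp))
  have h2 : ∀ k ∈ K, ∫⁻ θ in A k, ∫⁻ x, ψ x ∂(M.law k θ) ∂(prior k) ≤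
      S + prior k (F k)ᶜ := by
    intro k hk
    rw [← lintegral_inter_add_sdiff _ (A k) (hF k)]
    refine add_le_add ?_ ?_
    · refine (setLIntegral_mono' ((hA k).inter (hF k)) fun θ hθ => hS k hk θ hθ.2 hθ.1).trans ?_
      rw [setLIntegral_const]
      exact mul_le_of_le_one_right' prob_le_one
    · refine (lintegral_mono fun θ => M.lintegral_law_le_one k θ hψ1).trans ?_
      rw [setLIntegral_one]
      exact measure_mono fun θ hθ => hθ.2
  have hm : ∀ k, Measurable fun x => ψ x * ∫⁻ θ in A k, M.density k θ x ∂(prior k) := fun k =>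
    hψ.mul (M.measurable_setLIntegral_density prior k (A k))
  calc _ = ∑' k, w k * ∫⁻ θ in A k, ∫⁻ x, ψ x ∂(M.law k θ) ∂(prior k) := by
        simp_rw [← ENNReal.tsum_mul_left, mul_left_comm (ψ _)]
        rw [lintegral_tsum fun k => ((hm k).const_mul (w k)).aemeasurable]
        refine tsum_congr fun k => ?_
        rw [lintegral_const_mul _ (hm k), M.lintegral_mul_setLIntegral_density prior k (A k) hψ]
    -- Models outside `K` are charged their full weight. Inside `K`, the error `S` is averaged with
    -- weights summing to one, so it is counted only once.
    _ ≤ ∑' k, (w k * S + (Kᶜ.indicator (fun k => w k) k +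
          K.indicator (fun k => w k * prior k (F k)ᶜ) k)) := by
        refine ENNReal.tsum_le_tsum fun k => ?_
        by_cases hk : k ∈ K
        · simpa [hk, mul_add] using mul_le_mul_right (h2 k hk) (w k)
        · simpa [hk] using (mul_le_of_le_one_right' (h1 k)).trans le_add_self
    _ = _ := by
        rw [ENNReal.tsum_add, ENNReal.tsum_add, ENNReal.tsum_mul_right, w.tsum_coe, one_mul,
          tsum_subtype, tsum_subtype K fun k => w k * prior k (F k)ᶜ]

/-- Expected empirical Bayes posterior mass of a set: test error, probability of small evidence,
and expected numerator. -/
theorem lintegral_posterior_selection_le (M : ModelFamily ν Θ) [SigmaFinite ν]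
    [Countable 𝒦] (prior : ∀ k, Measure (Θ k)) [∀ k, IsProbabilityMeasure (prior k)]
    (w : PMF 𝒦) (P : Measure 𝒳) [IsProbabilityMeasure P] (hP : P ≪ ν)
    {A : ∀ k, Set (Θ k)} (hA : ∀ k, MeasurableSet (A k)) {khat : 𝒳 → 𝒦}
    (hk : M.IsMaxMarginal prior w P khat) {φ : 𝒳 → ℝ≥0∞} (hφ : Measurable φ)
    (hφ1 : ∀ x, φ x ≤ 1) (l : 𝒦) {c : ℝ≥0∞} (hc0 : c ≠ 0) (hc1 : c ≠ ∞) :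
    ∫⁻ x, M.posterior prior (khat x) x (A (khat x)) ∂P ≤
      ∫⁻ x, φ x ∂P + P {x | w l * M.marginal prior l x ≤ c * P.rnDeriv ν x} +
        c⁻¹ * ∫⁻ x, (1 - φ x) * ∑' k, w k * ∫⁻ θ in A k, M.density k θ x ∂(prior k) ∂ν := by
  set E := {x | w l * M.marginal prior l x ≤ c * P.rnDeriv ν x} with hE
  have hp := Measure.measurable_rnDeriv P ν
  have hEm : MeasurableSet E :=
    measurableSet_le ((M.measurable_marginal prior l).const_mul _) (hp.const_mul _)
  set h : 𝒳 → ℝ≥0∞ :=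
    fun x => (1 - φ x) * ∑' k, w k * ∫⁻ θ in A k, M.density k θ x ∂(prior k) with hh
  have hhm : Measurable h := (measurable_const.sub hφ).mul
    (Measurable.tsum fun k => (M.measurable_setLIntegral_density prior k _).const_mul _)
  -- On `E` the posterior mass is bounded by one. Off `E` it is split as `φ + (1 - φ)`, and only the
  -- second part uses the domination by the hierarchical numerator.
  have key : ∀ᵐ x ∂P, M.posterior prior (khat x) x (A (khat x)) ≤
      φ x + E.indicator 1 x + c⁻¹ * ((P.rnDeriv ν x)⁻¹ * h x) := by
    filter_upwards [hk, Measure.rnDeriv_pos hP] with x hx hpx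
    by_cases hxE : x ∈ E
    · rw [indicator_of_mem hxE]
      exact (M.posterior_le_one prior _ x _).trans (le_add_self.trans le_self_add)
    · have hd0 : c * P.rnDeriv ν x ≠ 0 := mul_ne_zero hc0 hpx.ne'
      have h1 := M.posterior_le_of_isMaxOn prior w hx hA hd0 (not_le.1 hxE).le
      rw [ENNReal.mul_inv (.inl hc0) (.inl hc1)] at h1
      calc M.posterior prior (khat x) x (A (khat x))
          = (φ x + (1 - φ x)) * M.posterior prior (khat x) x (A (khat x)) := by
            rw [add_tsub_cancel_of_le (hφ1 x), one_mul]
        _ ≤ φ x + (1 - φ x) * M.posterior prior (khat x) x (A (khat x)) := by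
            rw [add_mul]
            gcongr
            exact mul_le_of_le_one_right' (M.posterior_le_one prior _ x _)
        _ ≤ φ x + (1 - φ x) * (c⁻¹ * (P.rnDeriv ν x)⁻¹ *
              ∑' k, w k * ∫⁻ θ in A k, M.density k θ x ∂(prior k)) := by gcongr
        _ = φ x + E.indicator 1 x + c⁻¹ * ((P.rnDeriv ν x)⁻¹ * h x) := by
            rw [indicator_of_notMem hxE, add_zero, hh]
            ring
  have hφE : Measurable fun x => φ x + E.indicator 1 x :=
    hφ.add (measurable_one.indicator hEm)
  have hph : Measurable fun x => (P.rnDeriv ν x)⁻¹ * h x := hp.inv.mul hhm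
  calc _ ≤ ∫⁻ x, (φ x + E.indicator 1 x + c⁻¹ * ((P.rnDeriv ν x)⁻¹ * h x)) ∂P :=
        lintegral_mono_ae key
    _ = ∫⁻ x, φ x ∂P + P E + c⁻¹ * ∫⁻ x, (P.rnDeriv ν x)⁻¹ * h x ∂P := by
        rw [lintegral_add_left hφE, lintegral_add_left hφ,
          lintegral_indicator_one hEm, lintegral_const_mul _ hph]
    _ ≤ _ := by
        refine add_le_add le_rfl (mul_le_mul_right ?_ _)
        -- Passing from `P` to `ν` produces the factor `dP/dν`, which cancels its inverse; only `≤
        -- 1` is available where the density is `0` or `∞`.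
        rw [← lintegral_rnDeriv_mul hP hph.aemeasurable]
        refine lintegral_mono fun x => ?_
        rw [← mul_assoc]
        exact mul_le_of_le_one_left' (ENNReal.mul_inv_le_one _)

/-- Exponential bound for the expected empirical Bayes posterior mass of the parameters with
loss at least `C₁ * ε ^ 2`. -/
theorem lintegral_posterior_loss_ge_le (M : ModelFamily ν Θ) [SigmaFinite ν] [Countable 𝒦]
    (prior : ∀ k, Measure (Θ k)) [∀ k, IsProbabilityMeasure (prior k)] (w : PMF 𝒦)
    (P : Measure 𝒳) [IsProbabilityMeasure P] {A F : ∀ k, Set (Θ k)}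
    (hA : ∀ k, MeasurableSet (A k)) (hF : ∀ k, MeasurableSet (F k)) (K : Set 𝒦)
    {khat : 𝒳 → 𝒦} (hkhat : M.IsMaxMarginal prior w P khat) {φ : 𝒳 → ℝ≥0∞}
    (hφ : Measurable φ) (hφ1 : ∀ x, φ x ≤ 1) {C C₂ C₃ ρ ε ε₀ : ℝ} (hρ : 1 < ρ)
    (hC₂ : 0 < C₂) (hC₃ : 0 < C₃) (hC : C₂ + C₃ + 2 < C) (hε₀ : 0 ≤ ε₀) (hε : ε₀ ≤ ε)
    (htest : (∫⁻ x, φ x ∂P) +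
        (⨆ (k ∈ K) (θ ∈ F k) (_ : θ ∈ A k), ∫⁻ x, (1 - φ x) ∂(M.law k θ)) ≤
      ENNReal.ofReal (Real.exp (-C * ε ^ 2)))
    (hsieve : (∑' k : ↥Kᶜ, w k) + (∑' k : ↥K, w k * prior k (F k)ᶜ) ≤
      ENNReal.ofReal (Real.exp (-C * ε ^ 2)))
    (l : 𝒦) (hl : ENNReal.ofReal (Real.exp (-C₂ * ε₀ ^ 2)) ≤ w l * prior l
      {θ | renyiDiv ρ P (M.law l θ) ≤ ((C₃ * ε₀ ^ 2 : ℝ) : EReal)}) :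
    ∫⁻ x, M.posterior prior (khat x) x (A (khat x)) ∂P ≤
      ENNReal.ofReal (3 * Real.exp (-ε ^ 2) + Real.exp (-(ρ - 1) * ε ^ 2)) := by
  set B := {θ | renyiDiv ρ P (M.law l θ) ≤ ((C₃ * ε₀ ^ 2 : ℝ) : EReal)} with hB
  have hεsq : ε₀ ^ 2 ≤ ε ^ 2 := by gcongr
  have hwB : w l * prior l B ≠ 0 := fun h => by
    rw [h] at hl
    exact absurd (ENNReal.ofReal_eq_zero.1 (le_antisymm hl zero_le)) (not_le.2 (Real.exp_pos _))
  have hw0 := left_ne_zero_of_mul hwB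
  have hB0 := right_ne_zero_of_mul hwB
  obtain ⟨θ₀, hθ₀⟩ := nonempty_of_measure_ne_zero hB0
  have hPν : P ≪ ν :=
    (absolutelyContinuous_of_renyiDiv_le hθ₀).trans (M.law_absolutelyContinuous l θ₀)
  -- In the exponent, `C₃` offsets the Rényi radius and the extra `1` leaves the evidence failure
  -- probability `exp (-(ρ - 1) ε²)`.
  set κ := ENNReal.ofReal (Real.exp (-(C₃ + 1) * ε ^ 2)) with hκ
  have hκ0 : κ ≠ 0 := by simp [hκ, Real.exp_pos]
  have hκ1 : κ ≠ ∞ := ENNReal.ofReal_ne_top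
  have hc0 : κ * (w l * prior l B) ≠ 0 := mul_ne_zero hκ0 hwB
  have hc1 : κ * (w l * prior l B) ≠ ∞ := ENNReal.mul_ne_top hκ1
    (ENNReal.mul_ne_top (w.apply_ne_top l) (measure_ne_top _ _))
  have hEv : P {x | w l * M.marginal prior l x ≤ κ * (w l * prior l B) * P.rnDeriv ν x} ≤
      ENNReal.ofReal (Real.exp (-(ρ - 1) * ε ^ 2)) := by
    refine (measure_mono fun x hx => ?_).trans
      ((M.measure_marginal_le_mul_le prior P hρ l hB0 hκ0 hκ1).trans ?_)
    · have e : κ * (w l * prior l B) * P.rnDeriv ν x =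
          w l * (κ * P.rnDeriv ν x * prior l B) := by ring
      have hx' : w l * M.marginal prior l x ≤ w l * (κ * P.rnDeriv ν x * prior l B) :=
        e ▸ hx
      exact (ENNReal.mul_le_mul_iff_right hw0 (w.apply_ne_top l)).1 hx'
    · have hs : 0 ≤ ρ - 1 := by linarith
      rw [hκ, ENNReal.ofReal_rpow_of_pos (Real.exp_pos _),
        ENNReal.ofReal_rpow_of_pos (Real.exp_pos _), ← ENNReal.ofReal_mul (by positivity),
        ← Real.exp_mul, ← Real.exp_mul, ← Real.exp_add]
      refine ENNReal.ofReal_le_ofReal (Real.exp_le_exp.2 ?_)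
      nlinarith [mul_le_mul_of_nonneg_left hεsq (mul_nonneg hC₃.le hs)]
  have hNum := M.lintegral_mul_tsum_setLIntegral_le prior w hF hA K
    (ψ := fun x => 1 - φ x) (measurable_const.sub hφ) (fun x => tsub_le_self)
    (S := ENNReal.ofReal (Real.exp (-C * ε ^ 2))) fun k hk θ hθF hθA =>
      le_trans (le_iSup₂_of_le k hk (le_iSup₂_of_le θ hθF
        (le_iSup (fun _ : θ ∈ A k => ∫⁻ x, (1 - φ x) ∂(M.law k θ)) hθA)))
        (le_add_self.trans htest)
  have hinv : (κ * (w l * prior l B))⁻¹ ≤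
      ENNReal.ofReal (Real.exp ((C₂ + C₃ + 1) * ε ^ 2)) := by
    rw [ENNReal.inv_le_iff_inv_le, ← ENNReal.ofReal_inv_of_pos (Real.exp_pos _), ← Real.exp_neg]
    calc _ ≤ κ * ENNReal.ofReal (Real.exp (-C₂ * ε₀ ^ 2)) := by
          rw [hκ, ← ENNReal.ofReal_mul (by positivity), ← Real.exp_add]
          refine ENNReal.ofReal_le_ofReal (Real.exp_le_exp.2 ?_)
          nlinarith
      _ ≤ _ := by gcongr
  have hε2 : 0 ≤ ε ^ 2 := sq_nonneg ε
  calc _ ≤ _ := M.lintegral_posterior_selection_le prior w P hPν hA hkhat hφ hφ1 l hc0 hc1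
    _ ≤ ENNReal.ofReal (Real.exp (-ε ^ 2)) + ENNReal.ofReal (Real.exp (-(ρ - 1) * ε ^ 2)) +
        ENNReal.ofReal (Real.exp ((C₂ + C₃ + 1) * ε ^ 2)) *
          (ENNReal.ofReal (Real.exp (-C * ε ^ 2)) + ENNReal.ofReal (Real.exp (-C * ε ^ 2))) := by
        refine add_le_add (add_le_add ((le_self_add.trans htest).trans ?_) hEv)
          (mul_le_mul' hinv (hNum.trans ?_))
        · refine ENNReal.ofReal_le_ofReal (Real.exp_le_exp.2 ?_)
          nlinarith
        · gcongr
    _ ≤ _ := by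
        rw [← ENNReal.ofReal_add (by positivity) (by positivity),
          ← ENNReal.ofReal_add (by positivity) (by positivity),
          ← ENNReal.ofReal_mul (by positivity),
          ← ENNReal.ofReal_add (by positivity) (by positivity)]
        refine ENNReal.ofReal_le_ofReal ?_
        -- The inverse evidence costs `C₂ + C₃ + 1`, so `C > C₂ + C₃ + 2` leaves a decay rate of at
        -- least one.
        have h1 : Real.exp ((C₂ + C₃ + 1) * ε ^ 2) * Real.exp (-C * ε ^ 2) ≤
            Real.exp (-ε ^ 2) := by
          rw [← Real.exp_add]
          refine Real.exp_le_exp.2 ?_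
          nlinarith
        linarith

/-! ### From tail masses to the expected loss -/

/-- Posterior expected loss of a selected model through its upper tail masses. -/
theorem lintegral_posterior_selection_le_tsum (M : ModelFamily ν Θ)
    (prior : ∀ k, Measure (Θ k)) [∀ k, SFinite (prior k)] [Countable 𝒦] [MeasurableSpace 𝒦]
    [DiscreteMeasurableSpace 𝒦] (P : Measure 𝒳) [IsProbabilityMeasure P]
    {f : ∀ k, Θ k → ℝ≥0∞} (hf : ∀ k, Measurable (f k)) {khat : 𝒳 → 𝒦} (hk : Measurable khat)
    {a b : ℝ} (ha : 0 ≤ a) (hb : 0 < b) :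
    ∫⁻ x, ∫⁻ θ, f (khat x) θ ∂(M.posterior prior (khat x) x) ∂P ≤
      ENNReal.ofReal a + ∑' n : ℕ, ENNReal.ofReal b *
        ∫⁻ x, M.posterior prior (khat x) x
          {θ | ENNReal.ofReal (a + b * n) ≤ f (khat x) θ} ∂P := by
  have hA : ∀ (n : ℕ) k, MeasurableSet {θ | ENNReal.ofReal (a + b * n) ≤ f k θ} := fun n k =>
    measurableSet_le measurable_const (hf k)
  have hm : ∀ n : ℕ, Measurable fun x => M.posterior prior (khat x) x
      {θ | ENNReal.ofReal (a + b * n) ≤ f (khat x) θ} := fun n =>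
    M.measurable_posterior_selection prior (hA n) hk
  have key : ∀ x, ∫⁻ θ, f (khat x) θ ∂(M.posterior prior (khat x) x) ≤
      ENNReal.ofReal a + ∑' n : ℕ, ENNReal.ofReal b * M.posterior prior (khat x) x
        {θ | ENNReal.ofReal (a + b * n) ≤ f (khat x) θ} := by
    intro x
    calc _ ≤ ∫⁻ θ, (ENNReal.ofReal a + ∑' n : ℕ,
          {θ | ENNReal.ofReal (a + b * n) ≤ f (khat x) θ}.indicator
            (fun _ => ENNReal.ofReal b) θ) ∂(M.posterior prior (khat x) x) :=
          lintegral_mono fun θ =>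
            (le_ofReal_add_tsum_ite ha hb _).trans_eq (by simp [indicator_apply])
      _ = ENNReal.ofReal a * M.posterior prior (khat x) x univ +
          ∑' n : ℕ, ENNReal.ofReal b * M.posterior prior (khat x) x
            {θ | ENNReal.ofReal (a + b * n) ≤ f (khat x) θ} := by
          rw [lintegral_add_left measurable_const, lintegral_const,
            lintegral_tsum fun n => (measurable_const.indicator (hA n _)).aemeasurable]
          simp_rw [lintegral_indicator_const (hA _ _)]
      _ ≤ _ := by
          gcongr
          exact mul_le_of_le_one_right' (M.posterior_le_one prior _ x _)
  refine (lintegral_mono key).trans (le_of_eq ?_)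
  rw [lintegral_add_left measurable_const, lintegral_const, measure_univ, mul_one,
    lintegral_tsum fun n => ((hm n).const_mul _).aemeasurable]
  simp_rw [lintegral_const_mul _ (hm _)]

end ModelFamily

theorem mainTheorem2 (C C₁ ρ : ℝ) (hC : 0 < C) (hC₁ : 0 < C₁) (hρ : 1 < ρ) :
    ∃ M : ℝ, 0 < M ∧
      ∀ (𝒳 : Type*) [MeasurableSpace 𝒳] (ν : Measure 𝒳) [SigmaFinite ν]
        (𝒦 : Type*) [Countable 𝒦] [MeasurableSpace 𝒦] [DiscreteMeasurableSpace 𝒦]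
        (Θ : 𝒦 → Type*) [∀ k, MeasurableSpace (Θ k)]
        (model : ModelFamily ν Θ)
        -- the prior on the model index and the priors within the models
        (w : PMF 𝒦) (prior : ∀ k, Measure (Θ k)) [∀ k, IsProbabilityMeasure (prior k)]
        -- the true distribution of the data and the loss
        (P : Measure 𝒳) [IsProbabilityMeasure P]
        (L : Measure 𝒳 → Measure 𝒳 → ℝ≥0∞)
        (_ : ∀ k, Measurable fun θ : Θ k => L P (model.law k θ))
        (ε₀ C₂ C₃ : ℝ), 1 ≤ ε₀ → 0 < C₂ → 0 < C₃ → C₂ + C₃ + 2 < C →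
        -- testing and sieve conditions
        (∀ ε : ℝ, ε₀ ≤ ε →
          ∃ (K : Set 𝒦) (F : ∀ k, Set (Θ k)) (φ : 𝒳 → ℝ≥0∞),
            (∀ k, MeasurableSet (F k)) ∧ Measurable φ ∧ (∀ x, φ x ≤ 1) ∧
            (∫⁻ x, φ x ∂P) +
                (⨆ (k ∈ K) (θ ∈ F k) (_ : ENNReal.ofReal (C₁ * ε ^ 2) ≤ L P (model.law k θ)),
                  ∫⁻ x, (1 - φ x) ∂(model.law k θ))
              ≤ ENNReal.ofReal (Real.exp (-C * ε ^ 2)) ∧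
            (∑' k : ↥Kᶜ, w k) + (∑' k : ↥K, w k * prior k (F k)ᶜ)
              ≤ ENNReal.ofReal (Real.exp (-C * ε ^ 2))) →
        -- prior mass condition
        (∃ kstar : 𝒦,
          ENNReal.ofReal (Real.exp (-C₂ * ε₀ ^ 2)) ≤
            w kstar * prior kstar
              {θ | renyiDiv ρ P (model.law kstar θ) ≤ ((C₃ * ε₀ ^ 2 : ℝ) : EReal)}) →
        -- risk bound for the empirical Bayes posterior
        ∀ khat : 𝒳 → 𝒦, Measurable khat → model.IsMaxMarginal prior w P khat →
          ∫⁻ x, (∫⁻ θ, L P (model.law (khat x) θ) ∂(model.posterior prior (khat x) x)) ∂P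
            ≤ ENNReal.ofReal (M * ε₀ ^ 2) := by
  have hs : 0 < ρ - 1 := by linarith
  have hsum : Summable fun n : ℕ => 3 * Real.exp (-1) ^ n + Real.exp (-(ρ - 1)) ^ n :=
    ((summable_geometric_of_lt_one (Real.exp_pos _).le (by simp)).mul_left 3).add
      (summable_geometric_of_lt_one (Real.exp_pos _).le (by simpa using hρ))
  have hnn : ∀ n : ℕ, 0 ≤ 3 * Real.exp (-1) ^ n + Real.exp (-(ρ - 1)) ^ n := fun n => by
    positivity
  have hT : 0 ≤ ∑' n : ℕ, (3 * Real.exp (-1) ^ n + Real.exp (-(ρ - 1)) ^ n) := tsum_nonneg hnn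
  -- The `1` pays for losses below the base level `C₁ * ε₀ ^ 2`, and the series for the staircase
  -- steps of width `C₁` above it.
  refine ⟨C₁ * (1 + ∑' n : ℕ, (3 * Real.exp (-1) ^ n + Real.exp (-(ρ - 1)) ^ n)), by positivity,
    ?_⟩
  intro 𝒳 _ ν _ 𝒦 _ _ _ Θ _ model w prior _ P _ L hL ε₀ C₂ C₃ hε₀ hC₂ hC₃ hlt htest hmass khat
    hkhat hmax
  obtain ⟨l, hl⟩ := hmass
  have hε₀' : 1 ≤ ε₀ ^ 2 := one_le_pow₀ hε₀
  have htail : ∀ n : ℕ, ∫⁻ x, model.posterior prior (khat x) x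
      {θ | ENNReal.ofReal (C₁ * ε₀ ^ 2 + C₁ * n) ≤ L P (model.law (khat x) θ)} ∂P ≤
        ENNReal.ofReal (3 * Real.exp (-1) ^ n + Real.exp (-(ρ - 1)) ^ n) := by
    intro n
    have hn : (0 : ℝ) ≤ n := n.cast_nonneg
    -- Taking `ε = √(ε₀ ^ 2 + n)` makes the testing threshold `C₁ * ε ^ 2` equal to the staircase
    -- level `C₁ * ε₀ ^ 2 + C₁ * n`.
    have hsq : √(ε₀ ^ 2 + n) ^ 2 = ε₀ ^ 2 + n := Real.sq_sqrt (by positivity)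
    have hle : ε₀ ≤ √(ε₀ ^ 2 + n) := Real.le_sqrt_of_sq_le (by linarith)
    obtain ⟨K, F, φ, hF, hφ, hφ1, h1, h2⟩ := htest _ hle
    have h3 := model.lintegral_posterior_loss_ge_le prior w P
      (A := fun k => {θ | ENNReal.ofReal (C₁ * √(ε₀ ^ 2 + n) ^ 2) ≤ L P (model.law k θ)})
      (fun k => measurableSet_le measurable_const (hL k)) hF K hmax hφ hφ1 hρ hC₂ hC₃ hlt
      (by linarith) hle h1 h2 l hl
    rw [hsq, mul_add] at h3
    refine h3.trans (ENNReal.ofReal_le_ofReal ?_)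
    rw [← Real.exp_nat_mul, ← Real.exp_nat_mul]
    refine add_le_add (mul_le_mul_of_nonneg_left (Real.exp_le_exp.2 ?_) (by norm_num))
      (Real.exp_le_exp.2 ?_)
    · linarith
    · nlinarith
  calc _ ≤ _ := model.lintegral_posterior_selection_le_tsum prior P
        (f := fun k θ => L P (model.law k θ)) hL hkhat (a := C₁ * ε₀ ^ 2) (by positivity) hC₁
    _ ≤ ENNReal.ofReal (C₁ * ε₀ ^ 2) + ∑' n : ℕ, ENNReal.ofReal C₁ *
          ENNReal.ofReal (3 * Real.exp (-1) ^ n + Real.exp (-(ρ - 1)) ^ n) := by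
        gcongr with n
        exact htail n
    _ ≤ _ := by
        rw [ENNReal.tsum_mul_left, ← ENNReal.ofReal_tsum_of_nonneg hnn hsum,
          ← ENNReal.ofReal_mul hC₁.le, ← ENNReal.ofReal_add (by positivity) (by positivity)]
        refine ENNReal.ofReal_le_ofReal ?_
        -- Since `ε₀ ^ 2 ≥ 1`, the constant contributed by the series is absorbed into a multiple of
        -- `ε₀ ^ 2`.
        nlinarith [mul_le_mul_of_nonneg_left hε₀' (mul_nonneg hC₁.le hT)]
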